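/- Let $\alpha>0$ and $d\ge 1$, and let $X_1,\dots,X_d$ be i.i.d. Pareto($\alpha$) random variables on $[1,\infty)$, i.e. with common density $f_1(x)=\alpha x^{-\alpha-1}$ for $x\ge 1$ and $f_1(x)=0$ for $x<1$. Put $f(\mathbf x)=\prod_{i=1}^d f_1(x_i)$, $S(\mathbf x)=x_1+\cdots+x_d$, and $\ell=\ell(\gamma)=\mathbb P(X_1+\cdots+X_d>\gamma)$. Let $\pi(\mathbf x)=\mathbf 1\{S(\mathbf x)>\gamma\}\,f(\mathbf x)/\ell$ be the zero-variance importance sampling density, let $\pi_i$ be its $i$-th marginal density, $$\pi_i(t)=\int_{\mathbb R^{d-1}}\pi(x_1,\dots,x_{i-1},t,x_{i+1},\dots,x_d)\,\prod_{j\ne i}\mathrm dx_j ,$$ and let $g(\mathbf x)=\prod_{i=1}^d\pi_i(x_i)$. For a random vector $\mathbf Y=(Y_1,\dots,Y_d)$ with density $g$, let $$Z=Z(\gamma)=\mathbf 1\{S(\mathbf Y)>\gamma\}\,\frac{f(\mathbf Y)}{g(\mathbf Y)},\qquad M_d=\max_{i\le d}Y_i ,$$ and let $\mathbb E[Z^2;M_d\le\gamma]$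 denote the expectation of $Z^2\,\mathbf 1\{M_d\le\gamma\}$. Then for every $\varepsilon>0$, $$\limsup_{\gamma\to\infty}\frac{\mathbb E[Z^2;M_d\le\gamma]}{\ell(\gamma)^{2-\varepsilon}}=0 .$$ -/

import Mathlib

open MeasureTheory ProbabilityTheory Filter
open scoped ENNReal

namespace SemiparametricCE

noncomputable section

/-- The sum `S(x) = x₁ + ⋯ + x_d`. -/
def jumpSum {d : ℕ} (x : Fin d → ℝ) : ℝ := ∑ i, x i

/-- The maximum `M_d = max_{i ≤ d} x_i` (used for `d ≥ 1` only). -/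
def jumpMax {d : ℕ} (x : Fin d → ℝ) : ℝ := ⨆ i, x i

/-- The joint law of `d` i.i.d. jumps with the Pareto(`α`) distribution on `[1, ∞)`. -/
def jumpLaw (α : ℝ) (d : ℕ) : Measure (Fin d → ℝ) :=
  Measure.pi fun _ => paretoMeasure 1 α

/-- The joint density `f(x) = ∏ f₁(x_i)` of the jumps, `f₁` the Pareto(`α`) density on `[1, ∞)`. -/
def jointDensity (α : ℝ) (d : ℕ) (x : Fin d → ℝ) : ℝ≥0∞ := ∏ i, paretoPDF 1 α (x i)

/-- The rare-event probability `ℓ(γ) = P(S(X) > γ)`. -/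
def ell (α : ℝ) (d : ℕ) (γ : ℝ) : ℝ≥0∞ := jumpLaw α d {x | γ < jumpSum x}

/-- The zero-variance importance sampling density `π(x) = 1{S(x) > γ} f(x) / ℓ`. -/
def zeroVarDensity (α : ℝ) (d : ℕ) (γ : ℝ) : (Fin d → ℝ) → ℝ≥0∞ :=
  Set.indicator {x | γ < jumpSum x} fun x => jointDensity α d x / ell α d γ

/-- The `i`-th marginal density `π_i(t)` of `π`: all coordinates other than the `i`-th are
integrated out, and the `i`-th is set to `t` (the base point `fun _ => t` matters only through
its `i`-th coordinate). -/
def marginalDensity (α : ℝ) (d : ℕ) (γ : ℝ) (i : Fin d) (t : ℝ) : ℝ≥0∞ :=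
  lmarginal (fun _ : Fin d => (volume : Measure ℝ)) {i}ᶜ (zeroVarDensity α d γ) fun _ => t

/-- The importance sampling density `g(x) = ∏ π_i(x_i)`. -/
def isDensity (α : ℝ) (d : ℕ) (γ : ℝ) (x : Fin d → ℝ) : ℝ≥0∞ :=
  ∏ i, marginalDensity α d γ i (x i)

/-- The law with density `g`, under which `Z` is simulated. -/
def isLaw (α : ℝ) (d : ℕ) (γ : ℝ) : Measure (Fin d → ℝ) :=
  (volume : Measure (Fin d → ℝ)).withDensity (isDensity α d γ)

/-- The single-run estimator `Z = 1{S(X) > γ} f(X) / g(X)`, as a function of the sample `X`. -/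
def estimator (α : ℝ) (d : ℕ) (γ : ℝ) : (Fin d → ℝ) → ℝ≥0∞ :=
  Set.indicator {x | γ < jumpSum x} fun x => jointDensity α d x / isDensity α d γ x

/-- The truncated second moment `E[Z² ; M_d ≤ γ]`, where `X ∼ g`. -/
def truncatedSecondMoment (α : ℝ) (d : ℕ) (γ : ℝ) : ℝ≥0∞ :=
  ∫⁻ x in {x | jumpMax x ≤ γ}, estimator α d γ x ^ 2 ∂(isLaw α d γ)

end

end SemiparametricCE

namespace SemiparametricCE

/-! ### Products of densities -/

/-! Since `g * Z ≤ f`, the truncated second moment under `g` is at most the first moment of `Z`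
under `f` on `{M_d ≤ γ}`. Let `T` be the Pareto tail.

One other jump beyond `γ - t` already makes the sum exceed `γ`, so `π_i(t) ≥ f₁(t) T(γ - t) / ℓ`
(`le_marginalDensity`), and hence `Z ≤ ∏ ℓ / T(γ - x_i)`. If the sum exceeds `γ` while every jump is
at most `γ`, some `x_k > γ/d` and another `x_j > (γ - x_k)/d` (`exists_two_jumps`). The factors with
`i ≠ k` are bounded because `ℓ` and `T(γ)` are comparable. Integrating over `x_j` cancels `1 / T(γ -
x_k)` up to `d^α`, and integrating over `x_k` leaves a multiple of `T(γ) ≤ ℓ`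
(`lintegral_pairWeight_le`).

The moment is thus at most `C ℓ²` with `C` independent of `γ`, and `ℓ → 0` concludes. -/

theorem lintegral_fin_prod_eq_prod {n : ℕ} {E : Type*} {mE : MeasurableSpace E}
    {μ : Fin n → Measure E} [∀ i, SigmaFinite (μ i)]
    {f : Fin n → E → ℝ≥0∞} (hf : ∀ i, Measurable (f i)) :
    ∫⁻ x, ∏ i, f i (x i) ∂(Measure.pi μ) = ∏ i, ∫⁻ x, f i x ∂(μ i) := by
  induction n with
  | zero => simp
  | succ n ih =>
    have e := (measurePreserving_piFinSuccAbove μ 0).symm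
    have hm : Measurable fun y : Fin n → E => ∏ i, f i.succ (y i) :=
      Finset.measurable_fun_prod _ fun i _ => (hf _).comp (measurable_pi_apply i)
    rw [← e.lintegral_comp (by fun_prop), Fin.prod_univ_succ, ← ih fun i => hf _]
    refine (lintegral_congr fun a => ?_).trans
      (lintegral_prod_mul (hf 0).aemeasurable hm.aemeasurable)
    rw [Fin.prod_univ_succ]
    rfl

theorem lintegral_fintype_prod_eq_prod {ι E : Type*} [Fintype ι]
    {mE : MeasurableSpace E} {μ : ι → Measure E} [∀ i, SigmaFinite (μ i)]
    {f : ι → E → ℝ≥0∞} (hf : ∀ i, Measurable (f i)) :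
    ∫⁻ x, ∏ i, f i (x i) ∂(Measure.pi μ) = ∏ i, ∫⁻ x, f i x ∂(μ i) := by
  let e := (Fintype.equivFin ι).symm
  rw [← (measurePreserving_piCongrLeft μ e).lintegral_comp (by fun_prop)]
  simp_rw [← e.prod_comp, MeasurableEquiv.coe_piCongrLeft, Equiv.piCongrLeft_apply_apply]
  exact lintegral_fin_prod_eq_prod fun i => hf _

theorem pi_withDensity {ι E : Type*} [Fintype ι]
    {mE : MeasurableSpace E} {μ : ι → Measure E} [∀ i, SigmaFinite (μ i)]
    {f : ι → E → ℝ≥0∞} (hf : ∀ i, Measurable (f i))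
    [∀ i, SigmaFinite ((μ i).withDensity (f i))] :
    Measure.pi (fun i => (μ i).withDensity (f i)) =
      (Measure.pi μ).withDensity fun x => ∏ i, f i (x i) := by
  refine Measure.pi_eq (μ := fun i => (μ i).withDensity (f i)) fun s hs => ?_
  rw [withDensity_apply _ (MeasurableSet.univ_pi hs),
    ← lintegral_indicator (MeasurableSet.univ_pi hs)]
  have h : (Set.univ.pi s).indicator (fun x => ∏ i, f i (x i)) =
      fun x => ∏ i, (s i).indicator (f i) (x i) := by
    ext x
    by_cases hx : x ∈ Set.univ.pi s
    · rw [Set.indicator_of_mem hx]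
      exact Finset.prod_congr rfl fun i _ => (Set.indicator_of_mem (hx i trivial) _).symm
    · rw [Set.indicator_of_notMem hx]
      obtain ⟨i, hi⟩ : ∃ i, x i ∉ s i := by simpa using hx
      exact (Finset.prod_eq_zero (Finset.mem_univ i) (Set.indicator_of_notMem hi _)).symm
  rw [h, lintegral_fintype_prod_eq_prod fun i => (hf i).indicator (hs i)]
  exact Finset.prod_congr rfl fun i _ => by
    rw [lintegral_indicator (hs i), withDensity_apply _ (hs i)]

/-! ### The Pareto tail -/

theorem measurable_paretoPDF (t r : ℝ) : Measurable (paretoPDF t r) :=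
  (measurable_paretoPDFReal t r).ennreal_ofReal

theorem jumpLaw_eq_withDensity {α : ℝ} (hα : 0 < α) (d : ℕ) :
    jumpLaw α d = volume.withDensity (jointDensity α d) := by
  have := isProbabilityMeasure_paretoMeasure one_pos hα
  unfold paretoMeasure at this
  exact pi_withDensity (μ := fun _ : Fin d => volume) fun _ => measurable_paretoPDF 1 α

/-- The tail `P(X₁ > u)` of the Pareto distribution. -/
noncomputable def paretoTail (α u : ℝ) : ℝ≥0∞ := paretoMeasure 1 α (Set.Ioi u)

theorem paretoTail_anti (α : ℝ) : Antitone (paretoTail α) := fun _ _ h =>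
  measure_mono (Set.Ioi_subset_Ioi h)

theorem paretoTail_le_one {α : ℝ} (hα : 0 < α) (u : ℝ) : paretoTail α u ≤ 1 :=
  have := isProbabilityMeasure_paretoMeasure one_pos hα
  prob_le_one

theorem paretoTail_ne_top {α : ℝ} (hα : 0 < α) (u : ℝ) : paretoTail α u ≠ ⊤ :=
  ((paretoTail_le_one hα u).trans_lt ENNReal.one_lt_top).ne

theorem paretoTail_of_one_le {α : ℝ} (hα : 0 < α) {u : ℝ} (hu : 1 ≤ u) :
    paretoTail α u = ENNReal.ofReal (u ^ (-α)) := by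
  have hu0 : 0 < u := by linarith
  have h1 : -(α + 1) < -1 := by linarith
  rw [paretoTail, paretoMeasure, withDensity_apply _ measurableSet_Ioi,
    setLIntegral_congr_fun (g := fun x => ENNReal.ofReal (α * x ^ (-(α + 1)))) measurableSet_Ioi,
    ← ofReal_integral_eq_lintegral_ofReal, integral_const_mul, integral_Ioi_rpow_of_lt h1 hu0]
  · congr 1
    rw [show -(α + 1) + 1 = -α by ring]
    field_simp
  · exact (integrableOn_Ioi_rpow_of_lt h1 hu0).const_mul _
  · rw [EventuallyLE, ae_restrict_iff' measurableSet_Ioi]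
    filter_upwards with x (hx : u < x)
    have : 0 < x := hu0.trans hx
    simp only [Pi.zero_apply]
    positivity
  · intro x (hx : u < x)
    simp only [paretoPDF_of_le (hu.trans hx.le), Real.one_rpow, mul_one]

theorem paretoTail_of_le_one {α : ℝ} (hα : 0 < α) {u : ℝ} (hu : u ≤ 1) :
    paretoTail α u = 1 := by
  refine le_antisymm (paretoTail_le_one hα u) ?_
  calc (1 : ℝ≥0∞) = paretoTail α 1 := by simp [paretoTail_of_one_le hα le_rfl]
    _ ≤ _ := paretoTail_anti α hu

theorem paretoTail_eq {α : ℝ} (hα : 0 < α) (u : ℝ) :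
    paretoTail α u = ENNReal.ofReal (max 1 u ^ (-α)) := by
  rcases le_total u 1 with hu | hu
  · simp [paretoTail_of_le_one hα hu, max_eq_left hu]
  · rw [paretoTail_of_one_le hα hu, max_eq_right hu]

theorem paretoTail_ne_zero {α : ℝ} (hα : 0 < α) (u : ℝ) : paretoTail α u ≠ 0 := by
  rw [paretoTail_eq hα, ne_eq, ENNReal.ofReal_eq_zero, not_le]
  positivity

/-- Scaling the threshold costs only a constant. Flattening the tail to `1` below `1` keeps this
valid for every real `u`, negative ones included. -/
theorem paretoTail_div_le {α : ℝ} (hα : 0 < α) {c u : ℝ} (hc : 1 ≤ c) :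
    paretoTail α (u / c) ≤ ENNReal.ofReal (c ^ α) * paretoTail α u := by
  have hc0 : 0 < c := by linarith
  rw [paretoTail_eq hα, paretoTail_eq hα, ← ENNReal.ofReal_mul (by positivity)]
  refine ENNReal.ofReal_le_ofReal ?_
  have h : max 1 u / c ≤ max 1 (u / c) := by
    rw [div_le_iff₀ hc0, max_mul_of_nonneg _ _ hc0.le, one_mul, div_mul_cancel₀ _ hc0.ne']
    exact max_le_max hc le_rfl
  calc max 1 (u / c) ^ (-α) ≤ (max 1 u / c) ^ (-α) :=
        Real.rpow_le_rpow_of_nonpos (by positivity) h (by linarith)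
    _ = c ^ α * max 1 u ^ (-α) := by
        rw [Real.div_rpow (by positivity) hc0.le, Real.rpow_neg hc0.le, div_inv_eq_mul, mul_comm]

theorem tendsto_paretoTail {α : ℝ} (hα : 0 < α) :
    Tendsto (paretoTail α) atTop (nhds 0) := by
  have h : Tendsto (fun u : ℝ => ENNReal.ofReal (u ^ (-α))) atTop (nhds 0) := by
    simpa using ENNReal.tendsto_ofReal (tendsto_rpow_neg_atTop hα)
  refine h.congr' ?_
  filter_upwards [eventually_ge_atTop 1] with u hu using (paretoTail_of_one_le hα hu).symm

/-! ### Events of the jump law -/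

theorem measurable_jumpSum {d : ℕ} : Measurable (jumpSum (d := d)) :=
  Finset.measurable_fun_sum _ fun i _ => measurable_pi_apply i

theorem exists_div_lt_of_lt_sum {ι : Type*} {s : Finset ι} {x : ι → ℝ} {γ c : ℝ} (hγ : 0 ≤ γ)
    (hc : 0 < c) (hs : (s.card : ℝ) ≤ c) (hx : γ < ∑ i ∈ s, x i) : ∃ i ∈ s, γ / c < x i := by
  by_contra! h
  have h1 : ∑ i ∈ s, x i ≤ s.card * (γ / c) := by
    simpa using Finset.sum_le_card_nsmul s x _ h
  have h2 : (s.card : ℝ) * (γ / c) ≤ c * (γ / c) := by gcongr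
  rw [mul_div_cancel₀ _ hc.ne'] at h2
  linarith

theorem jumpLaw_eval_gt {α : ℝ} (hα : 0 < α) {d : ℕ} (i : Fin d) (u : ℝ) :
    jumpLaw α d {x | u < x i} = paretoTail α u := by
  have := isProbabilityMeasure_paretoMeasure one_pos hα
  exact (measurePreserving_eval (fun _ : Fin d => paretoMeasure 1 α) i).measure_preimage
    measurableSet_Ioi.nullMeasurableSet

theorem ae_one_lt_jumpLaw {α : ℝ} (hα : 0 < α) (d : ℕ) :
    ∀ᵐ x ∂(jumpLaw α d), ∀ i, 1 < x i := by
  have := isProbabilityMeasure_paretoMeasure one_pos hα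
  have h : ∀ᵐ t ∂(paretoMeasure 1 α), 1 < t :=
    (mem_ae_iff_prob_eq_one measurableSet_Ioi).2 (paretoTail_of_le_one hα le_rfl)
  exact ae_all_iff.2 fun i =>
    (measurePreserving_eval (fun _ : Fin d => paretoMeasure 1 α) i).quasiMeasurePreserving.ae h

theorem paretoTail_le_ell {α : ℝ} (hα : 0 < α) {d : ℕ} (hd : 1 ≤ d) (γ : ℝ) :
    paretoTail α γ ≤ ell α d γ := by
  rw [← jumpLaw_eval_gt hα (⟨0, hd⟩ : Fin d) γ]
  refine measure_mono_ae ?_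
  filter_upwards [ae_one_lt_jumpLaw hα d] with x hx (h : γ < x _)
  exact h.trans_le (Finset.single_le_sum (f := x) (fun i _ => (one_pos.trans (hx i)).le)
    (Finset.mem_univ _))

/-- A sum above `γ` forces a jump above `γ / d`; then a union bound and scaling of the tail apply.
-/
theorem ell_le {α : ℝ} (hα : 0 < α) {d : ℕ} (hd : 1 ≤ d) {γ : ℝ} (hγ : 0 ≤ γ) :
    ell α d γ ≤ d * ENNReal.ofReal ((d : ℝ) ^ α) * paretoTail α γ := by
  have hd1 : (1 : ℝ) ≤ d := by exact_mod_cast hd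
  calc ell α d γ ≤ jumpLaw α d (⋃ i, {x | γ / d < x i}) := by
        refine measure_mono fun x hx => ?_
        obtain ⟨i, -, hi⟩ := exists_div_lt_of_lt_sum hγ (by positivity : (0 : ℝ) < d) (by simp) hx
        exact Set.mem_iUnion.2 ⟨i, hi⟩
    _ ≤ ∑ i : Fin d, jumpLaw α d {x | γ / d < x i} := measure_iUnion_fintype_le _ _
    _ = d * paretoTail α (γ / d) := by simp [jumpLaw_eval_gt hα]
    _ ≤ d * (ENNReal.ofReal ((d : ℝ) ^ α) * paretoTail α γ) := by
        gcongr
        exact paretoTail_div_le hα hd1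
    _ = _ := by ring

theorem ell_ne_zero {α : ℝ} (hα : 0 < α) {d : ℕ} (hd : 1 ≤ d) (γ : ℝ) : ell α d γ ≠ 0 :=
  ((pos_iff_ne_zero.2 (paretoTail_ne_zero hα γ)).trans_le (paretoTail_le_ell hα hd γ)).ne'

theorem ell_ne_top {α : ℝ} (hα : 0 < α) (d : ℕ) (γ : ℝ) : ell α d γ ≠ ⊤ := by
  have := isProbabilityMeasure_paretoMeasure one_pos hα
  unfold ell jumpLaw
  exact measure_ne_top _ _

theorem tendsto_ell {α : ℝ} (hα : 0 < α) {d : ℕ} (hd : 1 ≤ d) :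
    Tendsto (ell α d) atTop (nhds 0) := by
  have hc : (d : ℝ≥0∞) * ENNReal.ofReal ((d : ℝ) ^ α) ≠ ⊤ := by finiteness
  have h := ENNReal.Tendsto.const_mul (tendsto_paretoTail hα) (Or.inr hc)
  rw [mul_zero] at h
  refine tendsto_of_tendsto_of_tendsto_of_le_of_le' tendsto_const_nhds h
    (Eventually.of_forall fun _ => zero_le) ?_
  filter_upwards [eventually_ge_atTop 0] with γ hγ using ell_le hα hd hγ

theorem lintegral_jumpLaw_pair {α : ℝ} (hα : 0 < α) {d : ℕ} {j k : Fin d} (hkj : k ≠ j)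
    {φ : ℝ × ℝ → ℝ≥0∞} (hφ : Measurable φ) :
    ∫⁻ x, φ (x k, x j) ∂(jumpLaw α d) =
      ∫⁻ s, ∫⁻ u, φ (s, u) ∂(paretoMeasure 1 α) ∂(paretoMeasure 1 α) := by
  have := isProbabilityMeasure_paretoMeasure one_pos hα
  have hi : iIndepFun (fun (i : Fin d) (x : Fin d → ℝ) => x i) (jumpLaw α d) :=
    iIndepFun_pi (μ := fun _ : Fin d => paretoMeasure 1 α) (X := fun _ t => t)
      fun _ => aemeasurable_id
  have hp : IsProbabilityMeasure (jumpLaw α d) := by unfold jumpLaw; infer_instance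
  have h := (indepFun_iff_map_prod_eq_prod_map_map (measurable_pi_apply k).aemeasurable
    (measurable_pi_apply j).aemeasurable).1 (hi.indepFun hkj)
  have hm : ∀ i : Fin d, (jumpLaw α d).map (fun x => x i) = paretoMeasure 1 α := fun i =>
    (measurePreserving_eval (fun _ : Fin d => paretoMeasure 1 α) i).map_eq
  rw [hm, hm] at h
  rw [← lintegral_prod _ hφ.aemeasurable, ← h, lintegral_map hφ (by fun_prop)]

/-! ### The importance sampling density -/

theorem measurable_jointDensity (α : ℝ) (d : ℕ) : Measurable (jointDensity α d) :=
  Finset.measurable_fun_prod _ fun i _ => (measurable_paretoPDF 1 α).comp (measurable_pi_apply i)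

theorem measurable_zeroVarDensity (α : ℝ) (d : ℕ) (γ : ℝ) :
    Measurable (zeroVarDensity α d γ) :=
  ((measurable_jointDensity α d).div_const _).indicator
    (measurableSet_lt measurable_const measurable_jumpSum)

theorem measurable_isDensity (α : ℝ) (d : ℕ) (γ : ℝ) : Measurable (isDensity α d γ) :=
  Finset.measurable_fun_prod _ fun i _ =>
    (((measurable_zeroVarDensity α d γ).lmarginal _).comp
      (measurable_pi_lambda (fun (t : ℝ) (_ : Fin d) => t) fun _ => measurable_id)).comp
      (measurable_pi_apply i)

theorem measurable_estimator (α : ℝ) (d : ℕ) (γ : ℝ) : Measurable (estimator α d γ) :=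
  ((measurable_jointDensity α d).div (measurable_isDensity α d γ)).indicator
    (measurableSet_lt measurable_const measurable_jumpSum)

theorem le_marginalDensity {α : ℝ} (hα : 0 < α) {d : ℕ} {i j : Fin d} (hij : j ≠ i) (γ t : ℝ) :
    paretoPDF 1 α t / ell α d γ * paretoTail α (γ - t) ≤ marginalDensity α d γ i t := by
  classical
  -- The product of the `F k` is the density of the other jumps cut down to the event that jump `j`
  -- exceeds `γ - t`.
  let F : ({i}ᶜ : Finset (Fin d)) → ℝ → ℝ≥0∞ := fun k =>
    if k.1 = j then (Set.Ioi (γ - t)).indicator (paretoPDF 1 α) else paretoPDF 1 α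
  have hF : ∀ k, Measurable (F k) := fun k => by
    by_cases h : k.1 = j
    · simpa [F, h] using (measurable_paretoPDF 1 α).indicator measurableSet_Ioi
    · simpa [F, h] using measurable_paretoPDF 1 α
  have hFm : Measurable fun y : ({i}ᶜ : Finset (Fin d)) → ℝ => ∏ k, F k (y k) :=
    Finset.measurable_fun_prod _ fun k _ => (hF k).comp (measurable_pi_apply k)
  have hj : j ∈ ({i}ᶜ : Finset (Fin d)) := by simpa using hij
  have hI : ∏ k, ∫⁻ u, F k u = paretoTail α (γ - t) := by
    rw [Finset.prod_eq_single (⟨j, hj⟩ : ({i}ᶜ : Finset (Fin d)))]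
    · simp only [F, if_true]
      rw [lintegral_indicator measurableSet_Ioi, paretoTail, paretoMeasure,
        withDensity_apply _ measurableSet_Ioi]
    · intro k _ hk
      have : k.1 ≠ j := fun h => hk (Subtype.ext h)
      simp [F, this, lintegral_paretoPDF_eq_one one_pos hα]
    · simp
  rw [← hI, ← lintegral_fintype_prod_eq_prod hF, marginalDensity, lmarginal,
    ← lintegral_const_mul _ hFm]
  refine lintegral_mono fun y => ?_
  have hi : Function.updateFinset (fun _ : Fin d => t) {i}ᶜ y i = t := by
    simp [Function.updateFinset]
  have hk : ∀ k : ({i}ᶜ : Finset (Fin d)),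
      Function.updateFinset (fun _ : Fin d => t) {i}ᶜ y k = y k := fun k => by
    simp [Function.updateFinset]
  -- Where the product does not vanish, all `y k ≥ 1` and `y j > γ - t`, so the sum exceeds `γ`
  -- whatever the sign of `t`.
  by_cases hy : ∀ k, F k (y k) ≠ 0
  swap
  · push Not at hy
    obtain ⟨k, hk⟩ := hy
    rw [Finset.prod_eq_zero (f := fun k => F k (y k)) (Finset.mem_univ k) hk, mul_zero]
    exact zero_le
  have hyj : γ - t < y ⟨j, hj⟩ := by
    by_contra h
    exact hy ⟨j, hj⟩ (by simp only [F, if_true]; exact Set.indicator_of_notMem h _)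
  have hFy : ∀ k, F k (y k) = paretoPDF 1 α (y k) := fun k => by
    by_cases h : k.1 = j
    · obtain rfl : k = ⟨j, hj⟩ := Subtype.ext h
      simp only [F, if_true]
      exact Set.indicator_of_mem (Set.mem_Ioi.2 hyj) _
    · simp [F, h]
  have hy1 : ∀ k, 1 ≤ y k := fun k => by
    by_contra! h
    exact hy k (by rw [hFy, paretoPDF_of_lt h])
  have hS : γ < jumpSum (Function.updateFinset (fun _ : Fin d => t) {i}ᶜ y) := by
    rw [jumpSum, Fintype.sum_eq_add_sum_compl i, hi, ← Finset.sum_coe_sort]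
    simp_rw [hk]
    have := Finset.single_le_sum (f := y) (fun k _ => zero_le_one.trans (hy1 k))
      (Finset.mem_univ ⟨j, hj⟩)
    linarith
  have hf : jointDensity α d (Function.updateFinset (fun _ : Fin d => t) {i}ᶜ y) =
      paretoPDF 1 α t * ∏ k, paretoPDF 1 α (y k) := by
    rw [jointDensity, Fintype.prod_eq_mul_prod_compl i, hi, ← Finset.prod_coe_sort]
    simp_rw [hk]
  rw [zeroVarDensity, Set.indicator_of_mem (show _ ∈ {x | γ < jumpSum x} from hS), hf]
  simp_rw [hFy]
  rw [div_eq_mul_inv, div_eq_mul_inv, mul_right_comm]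

theorem jointDensity_div_isDensity_le {α : ℝ} (hα : 0 < α) {d : ℕ} [Nontrivial (Fin d)] (γ : ℝ)
    (x : Fin d → ℝ) :
    jointDensity α d x / isDensity α d γ x ≤ ∏ i, ell α d γ / paretoTail α (γ - x i) := by
  have hd : 1 ≤ d := by
    obtain ⟨i⟩ : Nonempty (Fin d) := inferInstance
    exact Nat.one_le_iff_ne_zero.2 fun h => by subst h; exact i.elim0
  have h0 := ell_ne_zero hα hd γ
  have h1 := ell_ne_top hα d γ
  refine ENNReal.div_le_of_le_mul ?_
  rw [isDensity, jointDensity, ← Finset.prod_mul_distrib]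
  refine Finset.prod_le_prod' fun i _ => ?_
  obtain ⟨j, hj⟩ := exists_ne i
  calc paretoPDF 1 α (x i) = ell α d γ / paretoTail α (γ - x i) *
        (paretoPDF 1 α (x i) / ell α d γ * paretoTail α (γ - x i)) := by
        rw [mul_comm (paretoPDF 1 α (x i) / ell α d γ), ← mul_assoc,
          ENNReal.div_mul_cancel (paretoTail_ne_zero hα _) (paretoTail_ne_top hα _),
          ENNReal.mul_div_cancel h0 h1]
    _ ≤ _ := by
        gcongr
        exact le_marginalDensity hα hj γ (x i)

/-! ### The second moment -/

theorem measurableSet_jumpMax_le {d : ℕ} (γ : ℝ) :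
    MeasurableSet {x : Fin d → ℝ | jumpMax x ≤ γ} :=
  measurableSet_le (Measurable.iSup fun i => measurable_pi_apply i) measurable_const

/-- A bounded jump vector with a large sum has two large jumps. -/
theorem exists_two_jumps {d : ℕ} (hd : 1 ≤ d) {γ : ℝ} (hγ : 0 ≤ γ) {x : Fin d → ℝ}
    (hx : ∀ i, x i ≤ γ) (hS : γ < jumpSum x) :
    ∃ k j, k ≠ j ∧ γ / d < x k ∧ (γ - x k) / d < x j := by
  classical
  have hd0 : (0 : ℝ) < d := by exact_mod_cast hd
  obtain ⟨k, -, hk⟩ := exists_div_lt_of_lt_sum hγ hd0 (by simp) hS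
  have hS' : γ - x k < ∑ i ∈ {k}ᶜ, x i := by
    rw [jumpSum, Fintype.sum_eq_add_sum_compl k] at hS
    linarith
  have hc : ((({k}ᶜ : Finset (Fin d)).card : ℕ) : ℝ) ≤ d := by
    exact_mod_cast (Finset.card_le_univ _).trans (by simp)
  obtain ⟨j, hj, hjx⟩ := exists_div_lt_of_lt_sum (sub_nonneg.2 (hx k)) hd0 hc hS'
  exact ⟨k, j, fun h => by simp [h] at hj, hk, hjx⟩

/-- The weight of a pair of large jumps `(s, u)`, the first of them of the order of `γ`. -/
noncomputable def pairWeight (α : ℝ) (d : ℕ) (γ : ℝ) : ℝ × ℝ → ℝ≥0∞ :=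
  Set.indicator {p | γ / d < p.1 ∧ p.1 ≤ γ ∧ (γ - p.1) / d < p.2}
    fun p => (paretoTail α (γ - p.1))⁻¹

theorem measurable_pairWeight (α : ℝ) (d : ℕ) (γ : ℝ) : Measurable (pairWeight α d γ) := by
  refine Measurable.indicator ?_ ?_
  · exact ((paretoTail_anti α).measurable.comp (measurable_const.sub measurable_fst)).inv
  · exact (measurableSet_lt measurable_const measurable_fst).inter
      ((measurableSet_le measurable_fst measurable_const).inter
        (measurableSet_lt (by fun_prop) measurable_snd))

theorem lintegral_pairWeight_le {α : ℝ} (hα : 0 < α) {d : ℕ} (hd : 1 ≤ d) (γ : ℝ) :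
    ∫⁻ s, ∫⁻ u, pairWeight α d γ (s, u) ∂(paretoMeasure 1 α) ∂(paretoMeasure 1 α) ≤
      ENNReal.ofReal ((d : ℝ) ^ α) ^ 2 * paretoTail α γ := by
  have hd1 : (1 : ℝ) ≤ d := by exact_mod_cast hd
  have hs : ∀ s, ∫⁻ u, pairWeight α d γ (s, u) ∂(paretoMeasure 1 α) ≤
      (Set.Ioi (γ / d)).indicator (fun _ => ENNReal.ofReal ((d : ℝ) ^ α)) s := fun s => by
    by_cases h : γ / d < s
    · rw [Set.indicator_of_mem (Set.mem_Ioi.2 h)]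
      calc ∫⁻ u, pairWeight α d γ (s, u) ∂(paretoMeasure 1 α)
          -- The constraint `s ≤ γ` is dropped: the tail bounds hold without it.
          ≤ ∫⁻ u, (Set.Ioi ((γ - s) / d)).indicator
              (fun _ => (paretoTail α (γ - s))⁻¹) u ∂(paretoMeasure 1 α) := by
            refine lintegral_mono fun u => ?_
            by_cases hu : (γ - s) / d < u
            · rw [Set.indicator_of_mem (Set.mem_Ioi.2 hu)]
              exact Set.indicator_le_self _ _ (s, u)
            · simp [pairWeight, hu]
        _ = (paretoTail α (γ - s))⁻¹ * paretoTail α ((γ - s) / d) := by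
            rw [lintegral_indicator_const measurableSet_Ioi, paretoTail, paretoTail]
        _ ≤ (paretoTail α (γ - s))⁻¹ *
              (ENNReal.ofReal ((d : ℝ) ^ α) * paretoTail α (γ - s)) := by
            gcongr
            exact paretoTail_div_le hα hd1
        _ = _ := by
            rw [mul_left_comm, ENNReal.inv_mul_cancel (paretoTail_ne_zero hα _)
              (paretoTail_ne_top hα _), mul_one]
    · simp [pairWeight, h]
  calc _ ≤ ∫⁻ s, (Set.Ioi (γ / d)).indicator (fun _ => ENNReal.ofReal ((d : ℝ) ^ α)) s
        ∂(paretoMeasure 1 α) := lintegral_mono hs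
    _ = ENNReal.ofReal ((d : ℝ) ^ α) * paretoTail α (γ / d) := by
        rw [lintegral_indicator_const measurableSet_Ioi, paretoTail]
    _ ≤ ENNReal.ofReal ((d : ℝ) ^ α) * (ENNReal.ofReal ((d : ℝ) ^ α) * paretoTail α γ) := by
        gcongr
        exact paretoTail_div_le hα hd1
    _ = _ := by ring

theorem estimator_le {α : ℝ} (hα : 0 < α) {d : ℕ} (hd : 1 ≤ d) {γ : ℝ} (hγ : 0 ≤ γ)
    {x : Fin d → ℝ} (hx1 : ∀ i, 1 ≤ x i) (hx : ∀ i, x i ≤ γ) :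
    estimator α d γ x ≤ ell α d γ * (d * ENNReal.ofReal ((d : ℝ) ^ α)) ^ (d - 1) *
      ∑ p ∈ (Finset.univ : Finset (Fin d)).offDiag, pairWeight α d γ (x p.1, x p.2) := by
  classical
  by_cases hS : γ < jumpSum x
  swap
  · rw [estimator, Set.indicator_of_notMem (show x ∉ {x | γ < jumpSum x} from hS)]
    exact zero_le
  obtain ⟨k, j, hkj, hk, hj⟩ := exists_two_jumps hd hγ hx hS
  have : Nontrivial (Fin d) := ⟨k, j, hkj⟩
  have hw : pairWeight α d γ (x k, x j) = (paretoTail α (γ - x k))⁻¹ :=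
    Set.indicator_of_mem (s := {p : ℝ × ℝ | γ / d < p.1 ∧ p.1 ≤ γ ∧ (γ - p.1) / d < p.2})
      ⟨hk, hx k, hj⟩ _
  rw [estimator, Set.indicator_of_mem (show x ∈ {x | γ < jumpSum x} from hS)]
  calc jointDensity α d x / isDensity α d γ x
      ≤ ∏ i, ell α d γ / paretoTail α (γ - x i) := jointDensity_div_isDensity_le hα γ x
    _ = ell α d γ / paretoTail α (γ - x k) *
          ∏ i ∈ {k}ᶜ, ell α d γ / paretoTail α (γ - x i) := Fintype.prod_eq_mul_prod_compl k _
    _ ≤ ell α d γ / paretoTail α (γ - x k) *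
          ∏ _i ∈ ({k}ᶜ : Finset (Fin d)), (d * ENNReal.ofReal ((d : ℝ) ^ α) : ℝ≥0∞) := by
        -- As `x i ≥ 1 > 0`, the tail at `γ - x i` is at least the tail at `γ`, which is comparable
        -- to `ℓ`.
        gcongr with i
        refine ENNReal.div_le_of_le_mul ((ell_le hα hd hγ).trans ?_)
        gcongr
        exact paretoTail_anti α (by linarith [hx1 i])
    _ = ell α d γ * (d * ENNReal.ofReal ((d : ℝ) ^ α)) ^ (d - 1) *
          pairWeight α d γ (x k, x j) := by
        rw [Finset.prod_const, Finset.card_compl, Finset.card_singleton, Fintype.card_fin, hw,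
          div_eq_mul_inv, mul_right_comm]
    _ ≤ _ := by
        gcongr
        exact Finset.single_le_sum (f := fun p : Fin d × Fin d => pairWeight α d γ (x p.1, x p.2))
          (fun _ _ => zero_le) (a := (k, j)) (Finset.mem_offDiag.2 ⟨Finset.mem_univ k, Finset.mem_univ j, hkj⟩)

/-- For `d = 1` there are no pairs, and the bound is `0`. -/
theorem truncatedSecondMoment_le {α : ℝ} (hα : 0 < α) {d : ℕ} (hd : 1 ≤ d) {γ : ℝ}
    (hγ : 0 ≤ γ) :
    truncatedSecondMoment α d γ ≤ (d * ENNReal.ofReal ((d : ℝ) ^ α)) ^ (d - 1) *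
      ((Finset.univ : Finset (Fin d)).offDiag.card * ENNReal.ofReal ((d : ℝ) ^ α) ^ 2) *
      ell α d γ ^ 2 := by
  set D := (d * ENNReal.ofReal ((d : ℝ) ^ α)) ^ (d - 1)
  set O := (Finset.univ : Finset (Fin d)).offDiag with hO
  have hm : ∀ p : Fin d × Fin d,
      Measurable fun x : Fin d → ℝ => pairWeight α d γ (x p.1, x p.2) := fun p =>
    (measurable_pairWeight α d γ).comp
      ((measurable_pi_apply p.1).prodMk (measurable_pi_apply p.2))
  have hms : Measurable fun x : Fin d → ℝ => ∑ p ∈ O, pairWeight α d γ (x p.1, x p.2) :=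
    Finset.measurable_fun_sum _ fun p _ => hm p
  have hA := measurableSet_jumpMax_le (d := d) γ
  have hne : Nonempty (Fin d) := ⟨⟨0, hd⟩⟩
  calc truncatedSecondMoment α d γ
      = ∫⁻ x in {x | jumpMax x ≤ γ}, isDensity α d γ x * estimator α d γ x ^ 2 := by
        rw [truncatedSecondMoment, isLaw, restrict_withDensity hA,
          lintegral_withDensity_eq_lintegral_mul _ (measurable_isDensity α d γ)
            ((measurable_estimator α d γ).pow_const 2)]
        rfl
    _ ≤ ∫⁻ x in {x | jumpMax x ≤ γ}, jointDensity α d x *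
          (ell α d γ * D * ∑ p ∈ O, pairWeight α d γ (x p.1, x p.2)) := by
        refine setLIntegral_mono' hA fun x hx => ?_
        have hxi : ∀ i, x i ≤ γ := fun i => (le_ciSup (Set.finite_range x).bddAbove i).trans hx
        -- Only an inequality, since `g` could be `0` or `⊤` at `x`.
        have hZ : isDensity α d γ x * estimator α d γ x ≤ jointDensity α d x :=
          (mul_le_mul_right (Set.indicator_le_self _ _ x) _).trans ENNReal.mul_div_le
        rw [sq, ← mul_assoc]
        refine (mul_le_mul_left hZ _).trans ?_
        by_cases hx1 : ∀ i, 1 ≤ x i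
        · gcongr
          exact estimator_le hα hd hγ hx1 hxi
        · push Not at hx1
          obtain ⟨i, hi⟩ := hx1
          rw [jointDensity, Finset.prod_eq_zero (f := fun i => paretoPDF 1 α (x i))
            (Finset.mem_univ i) (paretoPDF_of_lt hi), zero_mul, zero_mul]
    _ ≤ ∫⁻ x, jointDensity α d x *
          (ell α d γ * D * ∑ p ∈ O, pairWeight α d γ (x p.1, x p.2)) :=
        setLIntegral_le_lintegral _ _
    _ = ell α d γ * D * ∑ p ∈ O, ∫⁻ x, pairWeight α d γ (x p.1, x p.2) ∂(jumpLaw α d) := by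
        rw [← lintegral_finsetSum _ fun p _ => hm p, ← lintegral_const_mul _ hms,
          jumpLaw_eq_withDensity hα,
          lintegral_withDensity_eq_lintegral_mul _ (measurable_jointDensity α d)
            (hms.const_mul _)]
        rfl
    _ ≤ ell α d γ * D * ∑ p ∈ O, ENNReal.ofReal ((d : ℝ) ^ α) ^ 2 * ell α d γ := by
        gcongr with p hp
        rw [lintegral_jumpLaw_pair hα (Finset.mem_offDiag.1 hp).2.2 (measurable_pairWeight α d γ)]
        refine (lintegral_pairWeight_le hα hd γ).trans ?_
        gcongr
        exact paretoTail_le_ell hα hd γ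
    _ = _ := by
        rw [Finset.sum_const, nsmul_eq_mul]
        ring

end SemiparametricCE

open SemiparametricCE in
theorem mainTheorem5 (α : ℝ) (hα : 0 < α) (d : ℕ) (hd : 1 ≤ d) (ε : ℝ) (hε : 0 < ε) :
    limsup (fun γ : ℝ =>
        SemiparametricCE.truncatedSecondMoment α d γ /
          SemiparametricCE.ell α d γ ^ (2 - ε)) atTop = 0 := by
  set C : ℝ≥0∞ := (d * ENNReal.ofReal ((d : ℝ) ^ α)) ^ (d - 1) *
    ((Finset.univ : Finset (Fin d)).offDiag.card * ENNReal.ofReal ((d : ℝ) ^ α) ^ 2) with hC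
  have hCt : C ≠ ⊤ := by rw [hC]; finiteness
  have hlim : Tendsto (fun γ => C * ell α d γ ^ ε) atTop (nhds 0) := by
    have h := ENNReal.Tendsto.const_mul ((tendsto_ell hα hd).ennrpow_const ε) (Or.inr hCt)
    simpa [ENNReal.zero_rpow_of_pos hε] using h
  refine Tendsto.limsup_eq (tendsto_of_tendsto_of_tendsto_of_le_of_le' tendsto_const_nhds hlim
    (Eventually.of_forall fun _ => zero_le) ?_)
  filter_upwards [eventually_ge_atTop 0] with γ hγ
  -- The exponent `2 - ε` may be negative, so adding exponents needs `ℓ` nonzero and finite.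
  have h0 := ell_ne_zero hα hd γ
  have h1 := ell_ne_top hα d γ
  refine ENNReal.div_le_of_le_mul ((truncatedSecondMoment_le hα hd hγ).trans_eq ?_)
  rw [← hC, mul_assoc C, ← ENNReal.rpow_add _ _ h0 h1, add_sub_cancel, ENNReal.rpow_two]
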